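/- Let $E=(E^0,E^1,r,s)$ be a directed graph with finitely many (and at least one) vertices and an arbitrary, possibly infinite, set of edges; loops and parallel edges are allowed. A path is a finite sequence of edges $e_1\cdots e_n$ ($n\ge 1$) with $r(e_i)=s(e_{i+1})$; it goes from $s(e_1)$ to $r(e_n)$, and it is a cycle if $s(e_1)=r(e_n)$. A single vertex counts as a path of length zero. Suppose that $E$ is strongly connected, that is, for all $v,w\in E^0$ there is a path from $v$ to $w$. Give $E^0$ the discrete topology and let $A=C_0(E^0)$. Let $X(E)$ be the $C^*$-correspondence over $A$ of all $\xi:E^1\to\mathbb{C}$ such that $v\mapsto\sum_{r(e)=v}|\xi(e)|^2$ is in $C_0(E^0)$, with $(a\cdot\xi)(e)=a(s(e))\xi(e)$, $(\xi\cdot a)(e)=\xi(e)a(r(e))$ and $\langle\xi,\eta\rangle(v)=\sum_{r(e)=v}\overline{\xi(e)}\eta(e)$. For $n\ge1$ let $X(E)^{\otimes n}$ be the $n$-fold ($A$-balanced, completed) interior tensor product, and let $X(E)^{\otimes 0}=A$ be the identity correspondence, with $\langle a,b\rangle=a^*b$ and with both actions given by multiplication. An isomorphism of $C^*$-correspondences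 is a bijection that preserves the left action and the $A$-valued inner product. Then the following are equivalent: 1. $X(E)$ is nonperiodic: for every integer $n\ge 0$, if $X(E)^{\otimes n}\cong A$ as $C^*$-correspondences, then $n=0$. 2. $E$ is not a simple cycle: there is no $k\ge1$ for which $E^0=\{v_1,\dots,v_k\}$ and $E^1=\{e_1,\dots,e_k\}$, with $k$ distinct vertices and $k$ distinct edges, $s(e_i)=v_i$ and $r(e_i)=v_{i+1}$ for all $i$, where $v_{k+1}=v_1$. 3. $E$ satisfies Condition (L): every cycle $e_1\cdots e_n$ in $E$ has an exit, that is, an edge $f$ with $s(f)=s(e_i)$ and $f\ne e_i$ for some $1\le i\le n$. -/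

import Mathlib

open scoped TensorProduct ZeroAtInfty

noncomputable section

universe u v w w'

/-- The algebraic data of a correspondence over `A` on a complex vector space `M`, without any
completeness or definiteness: an `A`-valued semi-inner product (conjugate-linear in the first
variable), a right action `ract a x = x · a` and a left action `lact a x = a · x` by adjointable
operators. -/
structure PreCorrespondence (A : Type u) [NonUnitalCStarAlgebra A]
    (M : Type w) [AddCommGroup M] [Module ℂ M] where
  inner : M →ₗ⋆[ℂ] M →ₗ[ℂ] A
  ract : A →ₗ[ℂ] M →ₗ[ℂ] M
  lact : A →ₗ[ℂ] M →ₗ[ℂ] M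
  star_inner : ∀ x y, star (inner x y) = inner y x
  /-- positivity of `⟨x, x⟩` in the C*-algebra `A` -/
  inner_self_pos : ∀ x, ∃ b, inner x x = star b * b
  inner_ract : ∀ x y a, inner x (ract a y) = inner x y * a
  ract_mul : ∀ a b x, ract (a * b) x = ract b (ract a x)
  lact_mul : ∀ a b x, lact (a * b) x = lact a (lact b x)
  lact_ract : ∀ a b x, lact a (ract b x) = ract b (lact a x)
  inner_lact : ∀ a x y, inner (lact a x) y = inner x (lact (star a) y)

namespace PreCorrespondence

variable {A : Type u} [NonUnitalCStarAlgebra A]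
variable {M : Type w} [AddCommGroup M] [Module ℂ M]
variable {N : Type w'} [AddCommGroup N] [Module ℂ N]
variable (P : PreCorrespondence A M) (Q : PreCorrespondence A N)

theorem inner_ract_left (x y : M) (a : A) : P.inner (P.ract a x) y = star a * P.inner x y := by
  rw [← P.star_inner, P.inner_ract, star_mul, P.star_inner]

theorem inner_nonneg [PartialOrder A] [StarOrderedRing A] (x : M) : 0 ≤ P.inner x x := by
  obtain ⟨b, hb⟩ := P.inner_self_pos x
  exact hb ▸ star_mul_self_nonneg b

/-- Cauchy-Schwarz. -/
theorem norm_inner_sq_le (x y : M) :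
    ‖P.inner x y‖ ^ 2 ≤ ‖P.inner x x‖ * ‖P.inner y y‖ := by
  let _ := CStarAlgebra.spectralOrder A
  have _ := CStarAlgebra.spectralOrderedRing A
  have key : ∀ c : ℝ, 0 < c → ‖P.inner x x‖ ≤ c → ‖P.inner x y‖ ^ 2 ≤ c * ‖P.inner y y‖ := by
    intro c hc hle
    set a := P.inner x y with ha
    have h1 : star a * P.inner x x * a ≤ c • (star a * a) :=
      (CStarAlgebra.star_left_conjugate_le_norm_smul
        (IsSelfAdjoint.of_nonneg (P.inner_nonneg x))).trans
        (smul_le_smul_of_nonneg_right hle (star_mul_self_nonneg a))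
    have h2 := P.inner_nonneg (P.ract a x - (c : ℂ) • y)
    have h3 : P.inner (P.ract a x - (c : ℂ) • y) (P.ract a x - (c : ℂ) • y)
        = star a * P.inner x x * a - c • (star a * a) - c • (star a * a)
          + (c * c) • P.inner y y := by
      have hyx : P.inner y x = star a := by rw [ha, P.star_inner]
      simp only [map_sub, LinearMap.sub_apply, P.inner_ract, P.inner_ract_left, map_smulₛₗ,
        LinearMap.smul_apply, hyx, ← ha, Complex.conj_ofReal, RingHom.id_apply]
      simp only [Complex.coe_smul]
      module
    rw [h3] at h2
    have h4 : c • (star a * a) ≤ (c * c) • P.inner y y := by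
      have : 0 ≤ c • (star a * a) - c • (star a * a) - c • (star a * a)
          + (c * c) • P.inner y y := h2.trans (by gcongr)
      rw [sub_self, zero_sub, neg_add_eq_sub, sub_nonneg] at this
      exact this
    have h5 := CStarAlgebra.norm_le_norm_of_nonneg_of_le
      (smul_nonneg hc.le (star_mul_self_nonneg a)) h4
    rw [norm_smul, norm_smul, CStarRing.norm_star_mul_self, Real.norm_of_nonneg hc.le,
      Real.norm_of_nonneg (mul_self_nonneg c), mul_assoc] at h5
    have := le_of_mul_le_mul_left h5 hc
    rwa [sq]
  refine le_of_forall_pos_le_add fun ε hε => ?_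
  have h := key (‖P.inner x x‖ + ε / (‖P.inner y y‖ + 1)) (by positivity)
    (le_add_of_nonneg_right (by positivity))
  refine h.trans ?_
  rw [add_mul]
  gcongr
  rw [div_mul_eq_mul_div, div_le_iff₀ (by positivity)]
  nlinarith [norm_nonneg (P.inner y y)]

/-- The seminorm `‖x‖ = ‖⟨x, x⟩‖ ^ (1 / 2)`. -/
def nrm (x : M) : ℝ := √‖P.inner x x‖

theorem nrm_sq (x : M) : P.nrm x ^ 2 = ‖P.inner x x‖ := Real.sq_sqrt (norm_nonneg _)

theorem norm_inner_le (x y : M) : ‖P.inner x y‖ ≤ P.nrm x * P.nrm y := by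
  rw [nrm, nrm, ← Real.sqrt_mul (norm_nonneg _)]
  exact Real.le_sqrt_of_sq_le (P.norm_inner_sq_le x y)

theorem nrm_smul (c : ℂ) (x : M) : P.nrm (c • x) = ‖c‖ * P.nrm x := by
  rw [nrm, LinearMap.map_smulₛₗ₂, map_smul, norm_smul, norm_smul, RCLike.norm_conj,
    ← mul_assoc, Real.sqrt_mul (by positivity), Real.sqrt_mul_self (norm_nonneg _), nrm]

theorem nrm_add_le (x y : M) : P.nrm (x + y) ≤ P.nrm x + P.nrm y := by
  refine Real.sqrt_le_iff.2 ⟨add_nonneg (Real.sqrt_nonneg _) (Real.sqrt_nonneg _), ?_⟩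
  rw [LinearMap.map_add₂, map_add, map_add]
  have h1 := P.norm_inner_le x y
  have h2 := P.norm_inner_le y x
  have h3 := P.nrm_sq x
  have h4 := P.nrm_sq y
  refine (norm_add_le _ _).trans ((add_le_add (norm_add_le _ _) (norm_add_le _ _)).trans ?_)
  nlinarith

/-- The vector space `M` equipped with the seminorm defined by the semi-inner product. -/
def Space (_ : PreCorrespondence A M) : Type w := M

instance : AddCommGroup P.Space := inferInstanceAs (AddCommGroup M)
instance : Module ℂ P.Space := inferInstanceAs (Module ℂ M)
instance : Norm P.Space := ⟨P.nrm⟩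

theorem core : SeminormedSpace.Core ℂ P.Space where
  norm_nonneg _ := Real.sqrt_nonneg _
  norm_smul := P.nrm_smul
  norm_triangle := P.nrm_add_le

instance : SeminormedAddCommGroup P.Space := SeminormedAddCommGroup.ofCore P.core
instance : NormedSpace ℂ P.Space where
  norm_smul_le c x := (P.nrm_smul c x).le

theorem nrm_ract_le (a : A) (x : M) : P.nrm (P.ract a x) ≤ ‖a‖ * P.nrm x := by
  refine Real.sqrt_le_iff.2 ⟨by unfold nrm; positivity, ?_⟩
  rw [P.inner_ract, P.inner_ract_left, mul_pow, P.nrm_sq]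
  refine (norm_mul_le _ _).trans ?_
  have := norm_mul_le (star a) (P.inner x x)
  rw [norm_star] at this
  nlinarith [norm_nonneg a]

theorem exists_defect (a : A) : ∃ d : A, IsSelfAdjoint d ∧
    (2 * ‖a‖) • d - d * d = star a * a := by
  set h := star a * a with hh
  have hsa : IsSelfAdjoint h := .star_mul_self a
  set f : ℝ → ℝ := fun x => ‖a‖ - √(‖a‖ ^ 2 - x) with hf
  have hf0 : f 0 = 0 := by simp [hf]
  have hfc : Continuous f := by fun_prop
  have hspec : ∀ x ∈ quasispectrum ℝ h, x ≤ ‖a‖ ^ 2 := by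
    intro x hx
    have h1 := NonUnitalIsometricContinuousFunctionalCalculus.norm_quasispectrum_le (𝕜 := ℝ) h hx
    rw [hh, CStarRing.norm_star_mul_self, ← sq] at h1
    exact (le_abs_self x).trans h1
  refine ⟨cfcₙ f h, cfcₙ_predicate f h, ?_⟩
  have hc := hfc.continuousOn (s := quasispectrum ℝ h)
  rw [← cfcₙ_mul f f h hc hf0 hc hf0, ← cfcₙ_smul (2 * ‖a‖) f h hc hf0,
    ← cfcₙ_sub (fun x => (2 * ‖a‖) • f x) (fun x => f x * f x) h (by fun_prop) (by simp [hf0])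
      (by fun_prop) (by simp [hf0])]
  conv_rhs => rw [← cfcₙ_id ℝ h]
  refine cfcₙ_congr fun x hx => ?_
  have := Real.sq_sqrt (sub_nonneg.2 (hspec x hx))
  simp only [hf, smul_eq_mul, id]
  nlinarith

theorem nrm_lact_le (a : A) (x : M) : P.nrm (P.lact a x) ≤ ‖a‖ * P.nrm x := by
  let _ := CStarAlgebra.spectralOrder A
  have _ := CStarAlgebra.spectralOrderedRing A
  obtain ⟨d, hd, hda⟩ := exists_defect a
  have h1 := P.inner_nonneg ((‖a‖ : ℂ) • x - P.lact d x)
  have h2 : P.inner ((‖a‖ : ℂ) • x - P.lact d x) ((‖a‖ : ℂ) • x - P.lact d x)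
      = (‖a‖ ^ 2) • P.inner x x - P.inner (P.lact a x) (P.lact a x) := by
    have e : P.inner (P.lact a x) (P.lact a x)
        = (2 * ‖a‖) • P.inner x (P.lact d x) - P.inner x (P.lact d (P.lact d x)) := by
      rw [P.inner_lact, ← P.lact_mul, ← hda, ← P.lact_mul, map_sub, LinearMap.sub_apply, map_sub,
        ← Complex.coe_smul, map_smul, LinearMap.smul_apply, map_smul, Complex.coe_smul]
    rw [e]
    simp only [map_sub, LinearMap.sub_apply, map_smulₛₗ, LinearMap.smul_apply,
      P.inner_lact, hd.star_eq, Complex.conj_ofReal, RingHom.id_apply]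
    simp only [Complex.coe_smul]
    module
  rw [h2, sub_nonneg] at h1
  have h3 := CStarAlgebra.norm_le_norm_of_nonneg_of_le (P.inner_nonneg _) h1
  refine Real.sqrt_le_iff.2 ⟨by unfold nrm; positivity, ?_⟩
  rw [mul_pow, P.nrm_sq]
  rwa [norm_smul, Real.norm_of_nonneg (by positivity)] at h3


theorem exists_negative_part {C : Type*} [NonUnitalCStarAlgebra C] {G : C}
    (hG : IsSelfAdjoint G) : ∃ m c : C, IsSelfAdjoint m ∧ m * G * m = -(m * m * m) ∧
      m * m * m = star c * c ∧ (c = 0 → ∃ B, G = star B * B) := by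
  let _ := CStarAlgebra.spectralOrder C
  have _ := CStarAlgebra.spectralOrderedRing C
  have hm0 : 0 ≤ G⁻ := CFC.negPart_nonneg G
  have hms : IsSelfAdjoint G⁻ := .of_nonneg hm0
  have hm3 : 0 ≤ G⁻ * G⁻ * G⁻ := by
    have := star_left_conjugate_nonneg hm0 G⁻
    rwa [hms.star_eq] at this
  obtain ⟨c, hc⟩ := CStarAlgebra.nonneg_iff_eq_star_mul_self.1 hm3
  refine ⟨G⁻, c, hms, ?_, hc, fun hc0 => ?_⟩
  · conv_lhs => rw [mul_assoc, ← CFC.posPart_sub_negPart G hG]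
    rw [CFC.posPart_sub_negPart G hG, ← mul_assoc]
    nth_rw 2 [← CFC.posPart_sub_negPart G hG]
    rw [mul_sub, CFC.negPart_mul_posPart, zero_sub, neg_mul]
  · have hm3z : G⁻ * G⁻ * G⁻ = 0 := by rw [hc, hc0, mul_zero]
    have hm2 : G⁻ * G⁻ = 0 := by
      rw [← CStarRing.star_mul_self_eq_zero_iff, star_mul, hms.star_eq, ← mul_assoc, hm3z,
        zero_mul]
    have hmz : G⁻ = 0 := by
      rw [← CStarRing.star_mul_self_eq_zero_iff, hms.star_eq, hm2]
    exact CStarAlgebra.nonneg_iff_eq_star_mul_self.1 ((CFC.negPart_eq_zero_iff G hG).1 hmz)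

theorem exists_gram_factor {k : ℕ} (x : Fin k → M) : ∃ B : Fin k → Fin k → A,
    ∀ i j, P.inner (x i) (x j) = ∑ l, star (B l i) * B l j := by
  let _ := CStarAlgebra.spectralOrder A
  have _ := CStarAlgebra.spectralOrderedRing A
  let G : CStarMatrix (Fin k) (Fin k) A := CStarMatrix.ofMatrix fun i j => P.inner (x i) (x j)
  have hG : ∀ i j, G i j = P.inner (x i) (x j) := fun _ _ => rfl
  have hGs : IsSelfAdjoint G := by
    ext i j
    rw [CStarMatrix.star_apply, hG, hG, P.star_inner]
  obtain ⟨m, c, hms, hmGm, hc, himp⟩ := exists_negative_part hGs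
  have hpos : ∀ l, 0 ≤ (m * G * m) l l := by
    intro l
    have h := P.inner_nonneg (∑ i, P.ract (m i l) (x i))
    convert h using 1
    simp only [CStarMatrix.mul_apply, map_sum, LinearMap.sum_apply, P.inner_ract,
      P.inner_ract_left, hG, Finset.sum_mul]
    refine Finset.sum_congr rfl fun j _ => Finset.sum_congr rfl fun i _ => ?_
    rw [CStarMatrix.star_apply_of_isSelfAdjoint hms]
  have hc0 : c = 0 := by
    ext i l
    have h1 : ∑ j, star (c j l) * c j l = 0 := by
      have h2 : (m * m * m) l l = ∑ j, star (c j l) * c j l := by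
        rw [hc, CStarMatrix.mul_apply]
        rfl
      have h3 := hpos l
      rw [hmGm] at h3
      have h4 : (m * m * m) l l ≤ 0 := neg_nonneg.1 h3
      exact le_antisymm (h2 ▸ h4) (Finset.sum_nonneg fun j _ => star_mul_self_nonneg _)
    have h5 := (Finset.sum_eq_zero_iff_of_nonneg fun j _ => star_mul_self_nonneg (c j l)).1 h1 i
      (Finset.mem_univ i)
    exact (CStarRing.star_mul_self_eq_zero_iff _).1 h5
  obtain ⟨B, hB⟩ := himp hc0
  refine ⟨fun i j => B i j, fun i j => ?_⟩
  rw [← hG, hB, CStarMatrix.mul_apply]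
  rfl

/-- The sesquilinear form on `M ⊗ N` with
`⟨x ⊗ y, x' ⊗ y'⟩ = ⟨y, ⟨x, x'⟩ · y'⟩`. -/
def tensorInner : M ⊗[ℂ] N →ₗ⋆[ℂ] M ⊗[ℂ] N →ₗ[ℂ] A :=
  TensorProduct.lift <| LinearMap.mk₂'ₛₗ (starRingEnd ℂ) (starRingEnd ℂ)
    (fun x y => TensorProduct.lift ((Q.lact ∘ₗ P.inner x).compr₂ (Q.inner y)))
    (fun _ _ _ => by ext; simp) (fun _ _ _ => by ext; simp)
    (fun _ _ _ => by ext; simp) (fun _ _ _ => by ext; simp)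

@[simp]
theorem tensorInner_tmul (x x' : M) (y y' : N) :
    tensorInner P Q (x ⊗ₜ y) (x' ⊗ₜ y') = Q.inner y (Q.lact (P.inner x x') y') := rfl

theorem tensorInner_self_pos (t : M ⊗[ℂ] N) : ∃ b, tensorInner P Q t t = star b * b := by
  let _ := CStarAlgebra.spectralOrder A
  have _ := CStarAlgebra.spectralOrderedRing A
  rw [← CStarAlgebra.nonneg_iff_eq_star_mul_self]
  obtain ⟨k, x, y, rfl⟩ := TensorProduct.exists_sum_tmul_eq t
  obtain ⟨B, hB⟩ := P.exists_gram_factor x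
  have h : tensorInner P Q (∑ j, x j ⊗ₜ y j) (∑ j, x j ⊗ₜ y j)
      = ∑ l, Q.inner (∑ i, Q.lact (B l i) (y i)) (∑ i, Q.lact (B l i) (y i)) := by
    simp only [map_sum, LinearMap.sum_apply, tensorInner_tmul, hB, Q.inner_lact, Q.lact_mul]
    conv_rhs => rw [Finset.sum_comm]
    refine Finset.sum_congr rfl fun j _ => ?_
    rw [Finset.sum_comm]
  rw [h]
  exact Finset.sum_nonneg fun l _ => Q.inner_nonneg _

/-- The algebraic interior tensor product: the semi-inner product, the right action
`(x ⊗ y) · a = x ⊗ (y · a)` and the left action `a · (x ⊗ y) = (a · x) ⊗ y` on `M ⊗ N`. The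
vectors `(x · a) ⊗ y - x ⊗ (a · y)` have seminorm zero, so that the Hausdorff completion is
`A`-balanced. -/
def tensor : PreCorrespondence A (M ⊗[ℂ] N) where
  inner := tensorInner P Q
  ract := LinearMap.lTensorHom M ∘ₗ Q.ract
  lact := LinearMap.rTensorHom N ∘ₗ P.lact
  star_inner s t := by
    induction s with
    | zero => simp
    | add s₁ s₂ h₁ h₂ => simp [h₁, h₂]
    | tmul x y =>
      induction t with
      | zero => simp
      | add t₁ t₂ h₁ h₂ => simp [h₁, h₂]
      | tmul x' y' =>
        rw [tensorInner_tmul, tensorInner_tmul, Q.star_inner, Q.inner_lact, P.star_inner]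
  inner_self_pos := tensorInner_self_pos P Q
  inner_ract s t a := by
    induction s with
    | zero => simp
    | add s₁ s₂ h₁ h₂ => rw [LinearMap.map_add₂, h₁, h₂, LinearMap.map_add₂, add_mul]
    | tmul x y =>
      induction t with
      | zero => simp
      | add t₁ t₂ h₁ h₂ => simp only [map_add, h₁, h₂, add_mul]
      | tmul x' y' => simp [Q.lact_ract, Q.inner_ract]
  ract_mul a b t := by
    induction t with
    | zero => simp
    | add t₁ t₂ h₁ h₂ => simp only [map_add, h₁, h₂]
    | tmul x y => simp [Q.ract_mul]
  lact_mul a b t := by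
    induction t with
    | zero => simp
    | add t₁ t₂ h₁ h₂ => simp only [map_add, h₁, h₂]
    | tmul x y => simp [P.lact_mul]
  lact_ract a b t := by
    induction t with
    | zero => simp
    | add t₁ t₂ h₁ h₂ => simp only [map_add, h₁, h₂]
    | tmul x y => simp
  inner_lact a s t := by
    induction s with
    | zero => simp
    | add s₁ s₂ h₁ h₂ => rw [map_add, LinearMap.map_add₂, h₁, h₂, LinearMap.map_add₂]
    | tmul x y =>
      induction t with
      | zero => simp
      | add t₁ t₂ h₁ h₂ => simp only [map_add, h₁, h₂]
      | tmul x' y' => simp [P.inner_lact]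

/-! ### Hausdorff completion -/

/-- The structure `P`, viewed on the seminormed space `P.Space`. -/
def onSpace : PreCorrespondence A P.Space := P

theorem norm_inner_space_le (x y : P.Space) : ‖P.onSpace.inner x y‖ ≤ ‖x‖ * ‖y‖ :=
  P.norm_inner_le x y

theorem norm_ract_space_le (a : A) (x : P.Space) : ‖P.onSpace.ract a x‖ ≤ ‖a‖ * ‖x‖ :=
  P.nrm_ract_le a x

theorem norm_lact_space_le (a : A) (x : P.Space) : ‖P.onSpace.lact a x‖ ≤ ‖a‖ * ‖x‖ :=
  P.nrm_lact_le a x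

open UniformSpace in
/-- The `A`-valued inner product on the Hausdorff completion, extended by continuity. -/
def complInner : Completion P.Space → Completion P.Space → A :=
  Function.curry <| (Completion.isDenseInducing_coe.prodMap Completion.isDenseInducing_coe).extend
    (fun p : P.Space × P.Space => P.onSpace.inner p.1 p.2)

theorem continuous_inner_space : Continuous fun p : P.Space × P.Space => P.onSpace.inner p.1 p.2 := by
  have hf : ∀ x y, ‖P.onSpace.inner x y‖ ≤ 1 * ‖x‖ * ‖y‖ := fun x y => by
    rw [one_mul]; exact P.norm_inner_space_le x y
  exact ((P.onSpace.inner.mkContinuous₂ 1 hf).continuous.comp continuous_fst).clm_apply continuous_snd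

open UniformSpace in
theorem complInner_coe (x y : P.Space) :
    P.complInner (x : Completion P.Space) (y : Completion P.Space) = P.onSpace.inner x y :=
  (Completion.isDenseInducing_coe.prodMap Completion.isDenseInducing_coe).extend_eq
    P.continuous_inner_space (x, y)

open UniformSpace in
theorem continuous_complInner :
    Continuous fun p : Completion P.Space × Completion P.Space => P.complInner p.1 p.2 := by
  let inner' : P.Space →+ P.Space →+ A :=
    { toFun := fun x => (P.onSpace.inner x).toAddMonoidHom
      map_zero' := by ext x; exact LinearMap.map_zero₂ P.onSpace.inner x
      map_add' := fun x y => by ext z; exact LinearMap.map_add₂ P.onSpace.inner x y z }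
  have : Continuous fun p : P.Space × P.Space => inner' p.1 p.2 := P.continuous_inner_space
  exact (Completion.isDenseInducing_toCompl P.Space).extend_Z_bilin
    (Completion.isDenseInducing_toCompl P.Space) this

section Act

open UniformSpace

variable {P}
variable {f : A →ₗ[ℂ] P.Space →ₗ[ℂ] P.Space} (hf : ∀ a x, ‖f a x‖ ≤ ‖a‖ * ‖x‖)

/-- An operator of a bounded linear action of `A`, extended to the Hausdorff completion. -/
def complOp (a : A) : Completion P.Space →L[ℂ] Completion P.Space :=
  ((Completion.toComplL (𝕜 := ℂ) (E := P.Space)).comp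
    ((f a).mkContinuous ‖a‖ (hf a))).extend
    Completion.toComplL

theorem complOp_coe (a : A) (x : P.Space) :
    complOp hf a (x : Completion P.Space) = (f a x : Completion P.Space) :=
  ContinuousLinearMap.extend_eq _ Completion.denseRange_coe
    (Completion.isUniformInducing_coe P.Space) x

/-- A bounded linear action of `A`, extended to the Hausdorff completion. -/
def complAct : A →ₗ[ℂ] Completion P.Space →ₗ[ℂ] Completion P.Space where
  toFun a := complOp hf a
  map_add' a b := by
    ext x
    induction x using Completion.induction_on with
    | hp =>
      exact isClosed_eq (complOp hf (a + b)).continuous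
              ((complOp hf a).continuous.add (complOp hf b).continuous)
    | ih x =>
      change complOp hf (a + b) _ = complOp hf a _ + complOp hf b _
      rw [complOp_coe, complOp_coe, complOp_coe, map_add]
      exact Completion.coe_add (α := P.Space) (f a x) (f b x)
  map_smul' c a := by
    ext x
    induction x using Completion.induction_on with
    | hp =>
      exact isClosed_eq (complOp hf (c • a)).continuous
              ((complOp hf a).continuous.const_smul c)
    | ih x =>
      change complOp hf (c • a) _ = c • complOp hf a _
      rw [complOp_coe, complOp_coe, map_smul]
      exact Completion.coe_smul (X := P.Space) c (f a x)

theorem complAct_coe (a : A) (x : P.Space) :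
    complAct hf a (x : Completion P.Space) = (f a x : Completion P.Space) :=
  complOp_coe hf a x

theorem continuous_complAct (a : A) : Continuous (complAct hf a) :=
  (complOp hf a).continuous

end Act

theorem continuous_complInner_comp {T : Type*} [TopologicalSpace T]
    {f g : T → UniformSpace.Completion P.Space} (hf : Continuous f) (hg : Continuous g) :
    Continuous fun t => P.complInner (f t) (g t) :=
  P.continuous_complInner.comp (hf.prodMk hg)

open UniformSpace in
theorem star_complInner (x y : Completion P.Space) :
    star (P.complInner x y) = P.complInner y x := by
  induction x, y using Completion.induction_on₂ with
  | hp =>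
    exact isClosed_eq (P.continuous_complInner_comp continuous_fst continuous_snd).star
      (P.continuous_complInner_comp continuous_snd continuous_fst)
  | ih x y =>
    simp only [complInner_coe]
    exact P.onSpace.star_inner x y

open UniformSpace in
/-- `complInner` as a sesquilinear map. -/
def complInnerₗ : Completion P.Space →ₗ⋆[ℂ] Completion P.Space →ₗ[ℂ] A :=
  have hr : ∀ x y z, P.complInner x (y + z) = P.complInner x y + P.complInner x z := by
    intro x y z
    induction x, y, z using Completion.induction_on₃ with
    | hp =>
      exact isClosed_eq (P.continuous_complInner_comp (by fun_prop) (by fun_prop))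
        ((P.continuous_complInner_comp (by fun_prop) (by fun_prop)).add
          (P.continuous_complInner_comp (by fun_prop) (by fun_prop)))
    | ih x y z =>
      rw [← Completion.coe_add]
      simp only [complInner_coe]
      exact map_add (P.onSpace.inner x) y z
  have hrs : ∀ (c : ℂ) x y, P.complInner x (c • y) = c • P.complInner x y := by
    intro c x y
    induction x, y using Completion.induction_on₂ with
    | hp =>
      exact isClosed_eq
        (P.continuous_complInner_comp continuous_fst (continuous_snd.const_smul c))
        ((P.continuous_complInner_comp continuous_fst continuous_snd).const_smul c)
    | ih x y =>
      rw [← Completion.coe_smul]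
      simp only [complInner_coe]
      exact map_smul (P.onSpace.inner x) c y
  LinearMap.mk₂'ₛₗ (starRingEnd ℂ) (RingHom.id ℂ) P.complInner
    (fun x y z => by
      rw [← P.star_complInner, hr, star_add, P.star_complInner, P.star_complInner])
    (fun c x y => by
      rw [← P.star_complInner, hrs, star_smul, P.star_complInner]; rfl)
    (fun x y z => hr x y z) (fun c x y => hrs c x y)

open UniformSpace in
/-- The extension of the structure of `M` to its Hausdorff completion by continuity. -/
def completionPre : PreCorrespondence A (Completion P.Space) where
  inner := P.complInnerₗ
  ract := complAct P.norm_ract_space_le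
  lact := complAct P.norm_lact_space_le
  star_inner := P.star_complInner
  inner_self_pos x := by
    let _ := CStarAlgebra.spectralOrder A
    have _ := CStarAlgebra.spectralOrderedRing A
    rw [← CStarAlgebra.nonneg_iff_eq_star_mul_self]
    change 0 ≤ P.complInner x x
    induction x using Completion.induction_on with
    | hp =>
      exact (CStarAlgebra.isClosed_nonneg (A := A)).preimage
        (P.continuous_complInner_comp continuous_id continuous_id)
    | ih x =>
      rw [complInner_coe]
      exact P.onSpace.inner_nonneg x
  inner_ract x y a := by
    change P.complInner x (complAct P.norm_ract_space_le a y) = P.complInner x y * a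
    induction x, y using Completion.induction_on₂ with
    | hp =>
      exact isClosed_eq
        (P.continuous_complInner_comp continuous_fst
          ((continuous_complAct P.norm_ract_space_le a).comp continuous_snd))
        ((P.continuous_complInner_comp continuous_fst continuous_snd).mul continuous_const)
    | ih x y =>
      rw [complAct_coe, complInner_coe, complInner_coe]
      exact P.onSpace.inner_ract x y a
  ract_mul a b x := by
    induction x using Completion.induction_on with
    | hp =>
      exact isClosed_eq (continuous_complAct _ _)
        ((continuous_complAct _ _).comp (continuous_complAct _ _))
    | ih x =>
      simp only [complAct_coe, P.onSpace.ract_mul]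
  lact_mul a b x := by
    induction x using Completion.induction_on with
    | hp =>
      exact isClosed_eq (continuous_complAct _ _)
        ((continuous_complAct _ _).comp (continuous_complAct _ _))
    | ih x =>
      simp only [complAct_coe, P.onSpace.lact_mul]
  lact_ract a b x := by
    induction x using Completion.induction_on with
    | hp =>
      exact isClosed_eq ((continuous_complAct _ _).comp (continuous_complAct _ _))
        ((continuous_complAct _ _).comp (continuous_complAct _ _))
    | ih x =>
      simp only [complAct_coe, P.onSpace.lact_ract]
  inner_lact a x y := by
    change P.complInner (complAct P.norm_lact_space_le a x) y
      = P.complInner x (complAct P.norm_lact_space_le (star a) y)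
    induction x, y using Completion.induction_on₂ with
    | hp =>
      exact isClosed_eq
        (P.continuous_complInner_comp
          ((continuous_complAct P.norm_lact_space_le a).comp continuous_fst) continuous_snd)
        (P.continuous_complInner_comp continuous_fst
          ((continuous_complAct P.norm_lact_space_le (star a)).comp continuous_snd))
    | ih x y =>
      rw [complAct_coe, complAct_coe, complInner_coe, complInner_coe]
      exact P.onSpace.inner_lact a x y

end PreCorrespondence

/-- A C*-correspondence over `A`: a right Hilbert `A`-module (complete for the norm
`‖x‖ = ‖⟨x, x⟩‖ ^ (1 / 2)`) with a left action of `A` by adjointable operators. -/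
structure CStarCorrespondence (A : Type u) [NonUnitalCStarAlgebra A] where
  Carrier : Type w
  [normedAddCommGroup : NormedAddCommGroup Carrier]
  [normedSpace : NormedSpace ℂ Carrier]
  [completeSpace : CompleteSpace Carrier]
  toPre : PreCorrespondence A Carrier
  norm_sq_eq : ∀ x, ‖x‖ ^ 2 = ‖toPre.inner x x‖

attribute [instance] CStarCorrespondence.normedAddCommGroup CStarCorrespondence.normedSpace
  CStarCorrespondence.completeSpace

/-- The Hausdorff completion of a semi-inner product correspondence. -/
def PreCorrespondence.completion {A : Type u} [NonUnitalCStarAlgebra A] {M : Type w}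
    [AddCommGroup M] [Module ℂ M] (P : PreCorrespondence A M) : CStarCorrespondence.{u, w} A where
  Carrier := UniformSpace.Completion P.Space
  toPre := P.completionPre
  norm_sq_eq x := by
    change ‖x‖ ^ 2 = ‖P.complInner x x‖
    induction x using UniformSpace.Completion.induction_on with
    | hp =>
      exact isClosed_eq (continuous_norm.pow 2)
        (P.continuous_complInner_comp continuous_id continuous_id).norm
    | ih x =>
      rw [P.complInner_coe, UniformSpace.Completion.norm_coe]
      exact P.nrm_sq x

namespace CStarCorrespondence

variable {A : Type u} [NonUnitalCStarAlgebra A]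

/-- The identity correspondence `A` over `A`: multiplication actions and `⟨a, b⟩ = a* b`. -/
def self (A : Type u) [NonUnitalCStarAlgebra A] : CStarCorrespondence.{u, u} A where
  Carrier := A
  toPre :=
    { inner := LinearMap.mk₂'ₛₗ (starRingEnd ℂ) (RingHom.id ℂ) (fun a b => star a * b)
        (by simp [add_mul]) (by simp [smul_mul_assoc]) (by simp [mul_add])
        (by simp [mul_smul_comm])
      ract := (LinearMap.mul ℂ A).flip
      lact := LinearMap.mul ℂ A
      star_inner := by simp
      inner_self_pos := fun a => ⟨a, rfl⟩
      inner_ract := by simp [mul_assoc]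
      ract_mul := by simp [mul_assoc]
      lact_mul := by simp [mul_assoc]
      lact_ract := by simp [mul_assoc]
      inner_lact := by simp [mul_assoc] }
  norm_sq_eq a := by
    change _ = ‖star a * a‖
    rw [CStarRing.norm_star_mul_self, sq]

/-- The interior (`A`-balanced, completed) tensor product `X ⊗_A Y`. -/
def tensor (X : CStarCorrespondence.{u, w} A) (Y : CStarCorrespondence.{u, w'} A) :
    CStarCorrespondence.{u, max w w'} A :=
  (X.toPre.tensor Y.toPre).completion

/-- The tensor power `X^{⊗ (n + 1)} = X ⊗_A (X ⊗_A (⋯ ⊗_A X))` with `n + 1` factors. -/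
def tensorPowSucc (X : CStarCorrespondence.{u, w} A) : ℕ → CStarCorrespondence.{u, w} A
  | 0 => X
  | n + 1 => X.tensor (X.tensorPowSucc n)

/-- `X ≅ Y` as C*-correspondences: there is a bijection that preserves the left action and the
inner product (it is then automatically linear and preserves the right action). -/
def IsIsomorphic (X : CStarCorrespondence.{u, w} A) (Y : CStarCorrespondence.{u, w'} A) : Prop :=
  ∃ Φ : X.Carrier → Y.Carrier, Function.Bijective Φ ∧
    (∀ a x, Φ (X.toPre.lact a x) = Y.toPre.lact a (Φ x)) ∧
    ∀ x x', Y.toPre.inner (Φ x) (Φ x') = X.toPre.inner x x'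

/-- `X^{⊗ n} ≅ A` as C*-correspondences, where `X^{⊗ 0}` is the identity correspondence `A`. -/
def TensorPowIsoSelf (X : CStarCorrespondence.{u, w} A) : ℕ → Prop
  | 0 => (self A).IsIsomorphic (self A)
  | n + 1 => (X.tensorPowSucc n).IsIsomorphic (self A)

/-- `X` is nonperiodic: `X^{⊗ n} ≅ A` implies `n = 0`. -/
def Nonperiodic (X : CStarCorrespondence.{u, w} A) : Prop :=
  ∀ n : ℕ, X.TensorPowIsoSelf n → n = 0

end CStarCorrespondence

/-- A definite and complete semi-inner product correspondence is a C*-correspondence. -/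
def PreCorrespondence.toCStar {A : Type u} [NonUnitalCStarAlgebra A] {M : Type w}
    [AddCommGroup M] [Module ℂ M] (P : PreCorrespondence A M)
    (hdef : ∀ x, P.inner x x = 0 → x = 0) (hcomplete : CompleteSpace P.Space) :
    CStarCorrespondence.{u, w} A where
  Carrier := P.Space
  normedAddCommGroup := NormedAddCommGroup.ofSeparation fun x hx => hdef x <| by
    have h := P.nrm_sq x
    rw [show P.nrm x = 0 from hx] at h
    exact norm_eq_zero.1 (by simpa using h.symm)
  normedSpace := { norm_smul_le := fun c x => (P.nrm_smul c x).le }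
  completeSpace := hcomplete
  toPre := P.onSpace
  norm_sq_eq := P.nrm_sq

/-! ### Directed graphs -/

/-- A directed graph `(E⁰, E¹, r, s)` with vertex set `V = E⁰` and edge set `E = E¹`; loops and
(possibly infinitely many) parallel edges are allowed. -/
structure DirectedGraph (V : Type u) (E : Type v) where
  r : E → V
  s : E → V

namespace DirectedGraph

variable {V : Type u} {E : Type v} (G : DirectedGraph V E)

section Correspondence

variable [TopologicalSpace V]

/-- `v ↦ ∑_{r(e) = v} g(e)` (sums converging unconditionally) is a function in `C₀(E⁰)`. -/
def FiberSumsC0 (g : E → ℝ) : Prop :=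
  ∃ f : C₀(V, ℝ), ∀ v, HasSum (fun e : {e : E // G.r e = v} => g e) (f v)

variable {G}

theorem FiberSumsC0.add {g h : E → ℝ} (hg : G.FiberSumsC0 g) (hh : G.FiberSumsC0 h) :
    G.FiberSumsC0 fun e => g e + h e := by
  obtain ⟨f, hf⟩ := hg
  obtain ⟨k, hk⟩ := hh
  exact ⟨f + k, fun v => (hf v).add (hk v)⟩

theorem FiberSumsC0.const_mul {g : E → ℝ} (hg : G.FiberSumsC0 g) (c : ℝ) :
    G.FiberSumsC0 fun e => c * g e := by
  obtain ⟨f, hf⟩ := hg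
  exact ⟨c • f, fun v => (hf v).mul_left c⟩

theorem FiberSumsC0.of_le [DiscreteTopology V] {g h : E → ℝ} (hg : G.FiberSumsC0 g)
    (h0 : ∀ e, 0 ≤ h e) (hle : ∀ e, h e ≤ g e) : G.FiberSumsC0 h := by
  obtain ⟨f, hf⟩ := hg
  have hs : ∀ v, Summable fun e : {e : E // G.r e = v} => h e := fun v =>
    (hf v).summable.of_nonneg_of_le (fun e => h0 e) (fun e => hle e)
  refine ⟨⟨⟨fun v => ∑' e : {e : E // G.r e = v}, h e, continuous_of_discreteTopology⟩, ?_⟩,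
    fun v => (hs v).hasSum⟩
  refine squeeze_zero (fun v => tsum_nonneg fun e => h0 e) (fun v => ?_) f.zero_at_infty'
  exact hasSum_le (f := fun e : {e : E // G.r e = v} => h e) (fun e => hle e) (hs v).hasSum (hf v)

variable (G)

/-- The vector space `X(E)` of all `ξ : E¹ → ℂ` such that `v ↦ ∑_{r(e) = v} |ξ(e)|²` is in
`C₀(E⁰)`. -/
def corrSubmodule [DiscreteTopology V] : Submodule ℂ (E → ℂ) where
  carrier := {ξ | G.FiberSumsC0 fun e => ‖ξ e‖ ^ 2}
  zero_mem' := ⟨0, fun v => by simp⟩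
  add_mem' {ξ η} hξ hη := by
    have hξ : G.FiberSumsC0 fun e => ‖ξ e‖ ^ 2 := hξ
    have hη : G.FiberSumsC0 fun e => ‖η e‖ ^ 2 := hη
    change G.FiberSumsC0 fun e => ‖(ξ + η) e‖ ^ 2
    refine ((hξ.add hη).const_mul 2).of_le (fun e => by positivity) fun e => ?_
    have h := norm_add_le (ξ e) (η e)
    simp only [Pi.add_apply]
    nlinarith [norm_nonneg (ξ e + η e), sq_nonneg (‖ξ e‖ - ‖η e‖)]
  smul_mem' c ξ hξ := by
    have hξ : G.FiberSumsC0 fun e => ‖ξ e‖ ^ 2 := hξ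
    have h := hξ.const_mul (‖c‖ ^ 2)
    change G.FiberSumsC0 fun e => ‖(c • ξ) e‖ ^ 2
    simpa only [Pi.smul_apply, smul_eq_mul, norm_mul, mul_pow] using h

theorem norm_apply_le_C0 (a : C₀(V, ℂ)) (v : V) : ‖a v‖ ≤ ‖a‖ :=
  a.toBCF.norm_coe_le_norm v

variable [DiscreteTopology V]

theorem mem_corrSubmodule {ξ : E → ℂ} :
    ξ ∈ G.corrSubmodule ↔ G.FiberSumsC0 fun e => ‖ξ e‖ ^ 2 := Iff.rfl

variable {G} in
theorem summable_inner {ξ η : E → ℂ} (hξ : ξ ∈ G.corrSubmodule) (hη : η ∈ G.corrSubmodule)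
    (v : V) : Summable fun e : {e : E // G.r e = v} => star (ξ e) * η e := by
  obtain ⟨f, hf⟩ := (G.mem_corrSubmodule.1 hξ).add (G.mem_corrSubmodule.1 hη)
  refine .of_norm_bounded (hf v).summable fun e => ?_
  rw [norm_mul, norm_star]
  nlinarith [sq_nonneg (‖ξ e‖ - ‖η e‖), sq_nonneg (‖ξ e‖ + ‖η e‖)]

/-- `⟨ξ, η⟩(v) = ∑_{r(e) = v} conj(ξ(e)) η(e)`, a function in `C₀(E⁰)`. -/
def corrInner (ξ η : G.corrSubmodule) : C₀(V, ℂ) where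
  toFun v := ∑' e : {e : E // G.r e = v}, star (ξ.1 e) * η.1 e
  continuous_toFun := continuous_of_discreteTopology
  zero_at_infty' := by
    obtain ⟨f, hf⟩ := (G.mem_corrSubmodule.1 ξ.2).add (G.mem_corrSubmodule.1 η.2)
    refine squeeze_zero_norm (fun v => ?_) f.zero_at_infty'
    refine tsum_of_norm_bounded (hf v) fun e => ?_
    rw [norm_mul, norm_star]
    nlinarith [sq_nonneg (‖ξ.1 e‖ - ‖η.1 e‖), sq_nonneg (‖ξ.1 e‖ + ‖η.1 e‖)]

theorem corrInner_apply (ξ η : G.corrSubmodule) (v : V) :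
    G.corrInner ξ η v = ∑' e : {e : E // G.r e = v}, star (ξ.1 e) * η.1 e := rfl

variable {G} in
theorem mul_mem {b : E → ℂ} {C : ℝ} (hb : ∀ e, ‖b e‖ ≤ C) {ξ : E → ℂ}
    (hξ : ξ ∈ G.corrSubmodule) : (fun e => b e * ξ e) ∈ G.corrSubmodule := by
  refine G.mem_corrSubmodule.2 ?_
  refine ((G.mem_corrSubmodule.1 hξ).const_mul (C ^ 2)).of_le (fun e => by positivity) fun e => ?_
  rw [norm_mul, mul_pow]
  gcongr
  exact hb e

/-- The algebraic structure of the graph correspondence: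
`(a · ξ)(e) = a(s(e)) ξ(e)`, `(ξ · a)(e) = ξ(e) a(r(e))` and
`⟨ξ, η⟩(v) = ∑_{r(e) = v} conj(ξ(e)) η(e)`. -/
def corrPre : PreCorrespondence C₀(V, ℂ) G.corrSubmodule where
  inner := LinearMap.mk₂'ₛₗ (starRingEnd ℂ) (RingHom.id ℂ) G.corrInner
    (fun ξ ξ' η => by
      ext v
      simp only [corrInner_apply, ZeroAtInftyContinuousMap.add_apply]
      rw [← (summable_inner ξ.2 η.2 v).tsum_add (summable_inner ξ'.2 η.2 v)]
      exact tsum_congr fun e => by simp [add_mul])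
    (fun c ξ η => by
      ext v
      simp only [corrInner_apply, ZeroAtInftyContinuousMap.smul_apply, smul_eq_mul]
      rw [← tsum_mul_left]
      exact tsum_congr fun e => by simp [mul_assoc])
    (fun ξ η η' => by
      ext v
      simp only [corrInner_apply, ZeroAtInftyContinuousMap.add_apply]
      rw [← (summable_inner ξ.2 η.2 v).tsum_add (summable_inner ξ.2 η'.2 v)]
      exact tsum_congr fun e => by simp [mul_add])
    (fun c ξ η => by
      ext v
      simp only [corrInner_apply, ZeroAtInftyContinuousMap.smul_apply, smul_eq_mul]
      rw [← tsum_mul_left]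
      exact tsum_congr fun e => by simp [mul_left_comm])
  ract := LinearMap.mk₂ ℂ
    (fun a ξ => ⟨fun e => a (G.r e) * ξ.1 e, mul_mem (fun _ => norm_apply_le_C0 a _) ξ.2⟩)
    (fun a b ξ => by ext e; simp [add_mul]) (fun c a ξ => by ext e; simp [mul_assoc])
    (fun a ξ η => by ext e; simp [mul_add]) (fun c a ξ => by ext e; simp [mul_left_comm])
  lact := LinearMap.mk₂ ℂ
    (fun a ξ => ⟨fun e => a (G.s e) * ξ.1 e, mul_mem (fun _ => norm_apply_le_C0 a _) ξ.2⟩)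
    (fun a b ξ => by ext e; simp [add_mul]) (fun c a ξ => by ext e; simp [mul_assoc])
    (fun a ξ η => by ext e; simp [mul_add]) (fun c a ξ => by ext e; simp [mul_left_comm])
  star_inner ξ η := by
    ext v
    change star (G.corrInner ξ η v) = G.corrInner η ξ v
    rw [corrInner_apply, corrInner_apply, tsum_star]
    exact tsum_congr fun e => by simp [mul_comm]
  inner_self_pos ξ := by
    obtain ⟨f, hf⟩ := ξ.2
    have h0 : ∀ v, 0 ≤ f v := fun v => (hf v).nonneg fun e => by positivity
    refine ⟨⟨⟨fun v => ((√(f v) : ℝ) : ℂ), continuous_of_discreteTopology⟩, ?_⟩, ?_⟩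
    · have h1 : Filter.Tendsto (fun v => ((√(f v) : ℝ) : ℂ)) (Filter.cocompact V)
          (nhds ((√0 : ℝ) : ℂ)) :=
        (Complex.continuous_ofReal.tendsto _).comp
          ((Real.continuous_sqrt.tendsto _).comp f.zero_at_infty')
      simpa using h1
    · ext v
      change G.corrInner ξ ξ v = star ((√(f v) : ℝ) : ℂ) * ((√(f v) : ℝ) : ℂ)
      rw [corrInner_apply]
      have h2 : star ((√(f v) : ℝ) : ℂ) * ((√(f v) : ℝ) : ℂ) = ((f v : ℝ) : ℂ) := by
        rw [RCLike.star_def, Complex.conj_ofReal, ← Complex.ofReal_mul,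
          Real.mul_self_sqrt (h0 v)]
      rw [h2]
      refine HasSum.tsum_eq ?_
      convert Complex.hasSum_ofReal.2 (hf v) using 2 with e
      rw [RCLike.star_def, Complex.conj_mul']
      push_cast
      rfl
  inner_ract ξ η a := by
    ext v
    change G.corrInner _ _ v = G.corrInner _ _ v * a v
    rw [corrInner_apply, corrInner_apply, ← tsum_mul_right]
    refine tsum_congr fun e => ?_
    obtain ⟨e, rfl⟩ := e
    simp [mul_comm, mul_left_comm, mul_assoc]
  ract_mul a b ξ := by ext e; simp [mul_assoc, mul_left_comm]
  lact_mul a b ξ := by ext e; simp [mul_assoc]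
  lact_ract a b ξ := by ext e; simp [mul_left_comm]
  inner_lact a ξ η := by
    ext v
    change G.corrInner _ _ v = G.corrInner _ _ v
    rw [corrInner_apply, corrInner_apply]
    exact tsum_congr fun e => by simp [mul_left_comm, mul_assoc]

theorem hasSum_corrInner (ξ : G.corrSubmodule) (v : V) :
    HasSum (fun e : {e : E // G.r e = v} => ‖ξ.1 e‖ ^ 2) ‖G.corrInner ξ ξ v‖ := by
  obtain ⟨f, hf⟩ := ξ.2
  convert hf v using 1
  have h : G.corrInner ξ ξ v = ((f v : ℝ) : ℂ) := by
    rw [corrInner_apply]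
    refine HasSum.tsum_eq ?_
    convert Complex.hasSum_ofReal.2 (hf v) using 2 with e
    rw [RCLike.star_def, Complex.conj_mul']
    push_cast
    rfl
  rw [h, Complex.norm_real, Real.norm_of_nonneg ((hf v).nonneg fun e => by positivity)]

theorem corrPre_definite (ξ : G.corrSubmodule) (h : G.corrPre.inner ξ ξ = 0) : ξ = 0 := by
  ext e
  have h1 := G.hasSum_corrInner ξ (G.r e)
  rw [show G.corrInner ξ ξ = 0 from h, ZeroAtInftyContinuousMap.zero_apply, norm_zero] at h1
  have h2 := congrFun ((hasSum_zero_iff_of_nonneg fun e => by positivity).1 h1) ⟨e, rfl⟩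
  simpa using h2

theorem sum_sq_le (x : G.corrSubmodule) (v : V) (F : Finset {e : E // G.r e = v}) :
    ∑ e ∈ F, ‖x.1 e‖ ^ 2 ≤ G.corrPre.nrm x ^ 2 := by
  rw [PreCorrespondence.nrm_sq]
  exact (sum_le_hasSum F (fun e _ => by positivity) (G.hasSum_corrInner x v)).trans
    (norm_apply_le_C0 _ v)

theorem nrm_le_of_sum_le (x : G.corrSubmodule) {C : ℝ} (hC : 0 ≤ C)
    (h : ∀ v (F : Finset {e : E // G.r e = v}), ∑ e ∈ F, ‖x.1 e‖ ^ 2 ≤ C ^ 2) :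
    G.corrPre.nrm x ≤ C := by
  refine Real.sqrt_le_iff.2 ⟨hC, ?_⟩
  rw [← ZeroAtInftyContinuousMap.norm_toBCF_eq_norm]
  refine (BoundedContinuousFunction.norm_le (sq_nonneg C)).2 fun v => ?_
  exact hasSum_le_of_sum_le (G.hasSum_corrInner x v) (h v)

theorem corr_complete : CompleteSpace G.corrPre.Space := by
  refine Metric.complete_of_cauchySeq_tendsto fun u hu => ?_
  let x : ℕ → G.corrSubmodule := u
  have hx : ∀ ε > 0, ∃ N, ∀ n ≥ N, ∀ m ≥ N, G.corrPre.nrm (x n - x m) ≤ ε := by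
    intro ε hε
    obtain ⟨N, hN⟩ := Metric.cauchySeq_iff.1 hu ε hε
    refine ⟨N, fun n hn m hm => ?_⟩
    have h := (hN n hn m hm).le
    rwa [dist_eq_norm] at h
  have hpt : ∀ e, ∃ z, Filter.Tendsto (fun n => (x n).1 e) Filter.atTop (nhds z) := by
    intro e
    refine cauchySeq_tendsto_of_complete (Metric.cauchySeq_iff.2 fun ε hε => ?_)
    obtain ⟨N, hN⟩ := hx (ε / 2) (half_pos hε)
    refine ⟨N, fun n hn m hm => ?_⟩
    have h1 := G.sum_sq_le (x n - x m) (G.r e) {⟨e, rfl⟩}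
    rw [Finset.sum_singleton] at h1
    have h2 := ((abs_le_of_sq_le_sq h1 (Real.sqrt_nonneg _)).trans' (le_abs_self _)).trans (hN n hn m hm)
    rw [dist_eq_norm]
    exact h2.trans_lt (half_lt_self hε)
  choose ξ hξ using hpt
  have hlim : ∀ ε > 0, ∃ N, ∀ n ≥ N, ∀ v (F : Finset {e : E // G.r e = v}),
      ∑ e ∈ F, ‖(x n).1 e - ξ e‖ ^ 2 ≤ ε ^ 2 := by
    intro ε hε
    obtain ⟨N, hN⟩ := hx ε hε
    refine ⟨N, fun n hn v F => ?_⟩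
    have ht : Filter.Tendsto (fun m => ∑ e ∈ F, ‖(x n).1 e - (x m).1 e‖ ^ 2) Filter.atTop
        (nhds (∑ e ∈ F, ‖(x n).1 e - ξ e‖ ^ 2)) :=
      tendsto_finsetSum _ fun e _ => ((tendsto_const_nhds.sub (hξ e)).norm).pow 2
    refine le_of_tendsto ht (Filter.eventually_atTop.2 ⟨N, fun m hm => ?_⟩)
    exact (G.sum_sq_le (x n - x m) v F).trans
      (pow_le_pow_left₀ (Real.sqrt_nonneg _) (hN n hn m hm) 2)
  have hle : ∀ n e, ‖ξ e‖ ^ 2 ≤ 2 * ‖(x n).1 e‖ ^ 2 + 2 * ‖(x n).1 e - ξ e‖ ^ 2 := by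
    intro n e
    have h := norm_sub_le ((x n).1 e) ((x n).1 e - ξ e)
    rw [sub_sub_cancel] at h
    nlinarith [norm_nonneg (ξ e), sq_nonneg (‖(x n).1 e‖ - ‖(x n).1 e - ξ e‖)]
  have hsd : ∀ n v, (∀ F : Finset {e : E // G.r e = v}, ∑ e ∈ F, ‖(x n).1 e - ξ e‖ ^ 2 ≤ 1 ^ 2) →
      Summable fun e : {e : E // G.r e = v} => ‖(x n).1 e - ξ e‖ ^ 2 := fun n v h =>
    summable_of_sum_le (fun e => by positivity) h
  have hmem : ξ ∈ G.corrSubmodule := by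
    have hs : ∀ v, Summable fun e : {e : E // G.r e = v} => ‖ξ e‖ ^ 2 := by
      intro v
      obtain ⟨N, hN⟩ := hlim 1 one_pos
      exact .of_nonneg_of_le (fun e => by positivity) (fun e => hle N e)
        (((G.hasSum_corrInner (x N) v).summable.mul_left 2).add
          ((hsd N v (hN N le_rfl v)).mul_left 2))
    refine ⟨⟨⟨fun v => ∑' e : {e : E // G.r e = v}, ‖ξ e‖ ^ 2, continuous_of_discreteTopology⟩,
      ?_⟩, fun v => (hs v).hasSum⟩
    refine Metric.tendsto_nhds.2 fun ε hε => ?_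
    obtain ⟨N, hN⟩ := hlim (√(ε / 4)) (Real.sqrt_pos.2 (by positivity))
    have h0 := (Metric.tendsto_nhds.1 (G.corrInner (x N) (x N)).zero_at_infty') (ε / 4)
      (by positivity)
    filter_upwards [h0] with v hv
    rw [dist_zero_right] at hv
    rw [dist_zero_right]
    change ‖∑' e : {e : E // G.r e = v}, ‖ξ e‖ ^ 2‖ < ε
    rw [Real.norm_of_nonneg (tsum_nonneg fun e => by positivity)]
    have hd := summable_of_sum_le (f := fun e : {e : E // G.r e = v} => ‖(x N).1 e - ξ e‖ ^ 2)
      (fun e => by positivity) (hN N le_rfl v)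
    have h1 := hasSum_le (f := fun e : {e : E // G.r e = v} => ‖ξ e‖ ^ 2)
      (fun e => hle N e) (hs v).hasSum
      (((G.hasSum_corrInner (x N) v).mul_left 2).add (hd.hasSum.mul_left 2))
    have h2 := hasSum_le_of_sum_le hd.hasSum (hN N le_rfl v)
    rw [Real.sq_sqrt (by positivity)] at h2
    have h3 : ‖G.corrInner (x N) (x N) v‖ < ε / 4 := hv
    linarith
  let y : G.corrSubmodule := ⟨ξ, hmem⟩
  let y' : G.corrPre.Space := y
  refine ⟨y', Metric.tendsto_atTop.2 fun ε hε => ?_⟩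
  obtain ⟨N, hN⟩ := hlim (ε / 2) (half_pos hε)
  refine ⟨N, fun n hn => ?_⟩
  rw [dist_eq_norm]
  have h := G.nrm_le_of_sum_le (x n - y) (half_pos hε).le (hN n hn)
  exact lt_of_le_of_lt h (half_lt_self hε)

/-- The graph correspondence `X(E)` over `C₀(E⁰)`, where `E⁰` carries the discrete topology. -/
def correspondence : CStarCorrespondence C₀(V, ℂ) :=
  G.corrPre.toCStar G.corrPre_definite G.corr_complete

end Correspondence

/-- A path `e₁ ⋯ eₙ` with `n ≥ 1`: a nonempty finite sequence of edges with
`r(eᵢ) = s(eᵢ₊₁)`. -/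
structure Path where
  edges : List E
  ne_nil : edges ≠ []
  chain : edges.IsChain fun e f => G.r e = G.s f

namespace Path

variable {G}

/-- `s(e₁ ⋯ eₙ) = s(e₁)` -/
def source (α : G.Path) : V := G.s (α.edges.head α.ne_nil)

/-- `r(e₁ ⋯ eₙ) = r(eₙ)` -/
def range (α : G.Path) : V := G.r (α.edges.getLast α.ne_nil)

/-- A cycle is a path with `s(e₁) = r(eₙ)`. -/
def IsCycle (α : G.Path) : Prop := α.source = α.range

/-- An exit for `e₁ ⋯ eₙ` is an edge `f` with `s(f) = s(eᵢ)` and `f ≠ eᵢ` for some `i`. -/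
def IsExit (α : G.Path) (f : E) : Prop := ∃ e ∈ α.edges, G.s f = G.s e ∧ f ≠ e

end Path

/-- For all vertices `v`, `w` there is a path from `v` to `w`; a single vertex counts as a path of
length zero. -/
def StronglyConnected : Prop :=
  ∀ v w : V, v = w ∨ ∃ α : G.Path, α.source = v ∧ α.range = w

/-- Every cycle has an exit. -/
def ConditionL : Prop :=
  ∀ α : G.Path, α.IsCycle → ∃ f, α.IsExit f

/-- The graph is a simple cycle: for some `k = n + 1 ≥ 1` it has exactly `k` distinct vertices
`v₀, …, vₙ` and exactly `k` distinct edges `e₀, …, eₙ`, where `eᵢ` goes from `vᵢ` to `vᵢ₊₁`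
(indices modulo `k`). -/
def IsSimpleCycle : Prop :=
  ∃ (n : ℕ) (v : Fin (n + 1) ≃ V) (e : Fin (n + 1) ≃ E),
    ∀ i, G.s (e i) = v i ∧ G.r (e i) = v (i + 1)

end DirectedGraph

end

/-! Elementary tensors of edge point masses see both ends of a path: on the tensor of `e₁, …, eₘ`
the left action of `a` is the scalar `a(s(e₁))`, its inner square is the point mass at `r(eₘ)`
(`inner_pathVec_self`), and tensors with different first edges are orthogonal
(`inner_pathVec_of_ne`).

Suppose `X(E)^{⊗m} ≅ A` with `m ≥ 1`. In `A` the left action and the inner product are supported at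
the same vertex, so every path of length `m` that the proof builds closes up. Moreover two edges
with a common source yield functions that are both nonzero at that vertex, although orthogonality
makes their product vanish there. Hence no cycle has an exit, against Condition (L).

Conversely, on a simple cycle `X(E)` is `A` with its left action twisted by the predecessor map of
the vertices. Twists compose under the tensor product (`IsTwistedSelf.tensor`), and the predecessor
map to the power of the number of vertices is the identity.

The remaining link is combinatorial (`StronglyConnected.isSimpleCycle`): a path can never leave a
cycle without exit, so strong connectedness makes that cycle the whole graph. -/

open scoped TensorProduct ZeroAtInfty

noncomputable section

/-! ### Elementary tensors and extension of maps to the completion. -/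

namespace CStarCorrespondence

universe u w w'

variable {A : Type u} [NonUnitalCStarAlgebra A]
  (X : CStarCorrespondence.{u, w} A) (Y : CStarCorrespondence.{u, w'} A)

/-- The class of the elementary tensor `x ⊗ y` in `X ⊗_A Y`. -/
def tmul (x : X.Carrier) (y : Y.Carrier) : (X.tensor Y).Carrier :=
  UniformSpace.Completion.coe' (α := (X.toPre.tensor Y.toPre).Space) (x ⊗ₜ[ℂ] y)

theorem inner_tmul (x x' : X.Carrier) (y y' : Y.Carrier) :
    (X.tensor Y).toPre.inner (X.tmul Y x y) (X.tmul Y x' y')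
      = Y.toPre.inner y (Y.toPre.lact (X.toPre.inner x x') y') :=
  (X.toPre.tensor Y.toPre).complInner_coe _ _

theorem lact_tmul (a : A) (x : X.Carrier) (y : Y.Carrier) :
    (X.tensor Y).toPre.lact a (X.tmul Y x y) = X.tmul Y (X.toPre.lact a x) y :=
  PreCorrespondence.complAct_coe (X.toPre.tensor Y.toPre).norm_lact_space_le a _

theorem tmul_smul_left (c : ℂ) (x : X.Carrier) (y : Y.Carrier) :
    X.tmul Y (c • x) y = c • X.tmul Y x y := by
  unfold tmul
  rw [← TensorProduct.smul_tmul']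
  exact UniformSpace.Completion.coe_smul (X := (X.toPre.tensor Y.toPre).Space) c _

theorem subsingleton_tensor [Subsingleton X.Carrier] : Subsingleton (X.tensor Y).Carrier := by
  have h : Subsingleton (X.toPre.tensor Y.toPre).Space :=
    inferInstanceAs (Subsingleton (X.Carrier ⊗[ℂ] Y.Carrier))
  refine subsingleton_of_forall_eq 0 fun x => ?_
  change UniformSpace.Completion (X.toPre.tensor Y.toPre).Space at x
  induction x using UniformSpace.Completion.induction_on with
  | hp => exact isClosed_singleton (X := UniformSpace.Completion (X.toPre.tensor Y.toPre).Space)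
  | ih x =>
    rw [Subsingleton.elim x 0]
    exact UniformSpace.Completion.coe_zero

/-- Serves the graph with no edges, where `X(E) = 0`. -/
theorem subsingleton_tensorPowSucc [Subsingleton X.Carrier] :
    ∀ n, Subsingleton (X.tensorPowSucc n).Carrier
  | 0 => ‹_›
  | n + 1 => X.subsingleton_tensor (X.tensorPowSucc n)

end CStarCorrespondence

/-- By the C*-identity, preserving the inner product makes `f` isometric for the seminorm, so it
extends to an isometry of the completion. The extension is onto because `f` already is. Thus an
identification of a completed tensor product with `A` can be built on the algebraic one. -/
theorem PreCorrespondence.exists_completion_linearMap {A : Type*} [NonUnitalCStarAlgebra A]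
    {M : Type*} [AddCommGroup M] [Module ℂ M] (P : PreCorrespondence A M) (f : M →ₗ[ℂ] A)
    (hf : Function.Surjective f) (hinner : ∀ x y, star (f x) * f y = P.inner x y) :
    ∃ g : P.completion.Carrier →ₗ[ℂ] A, Function.Bijective g ∧ Continuous g ∧
      (∀ x : P.Space, g (x : UniformSpace.Completion P.Space) = f x) ∧
      ∀ x y, star (g x) * g y = P.completion.toPre.inner x y := by
  have hnorm : ∀ x : P.Space, ‖f x‖ = ‖x‖ := fun x => by
    have h : ‖x‖ ^ 2 = ‖f x‖ ^ 2 := by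
      rw [sq ‖f x‖, ← CStarRing.norm_star_mul_self]
      exact (P.nrm_sq x).trans (congrArg norm (hinner x x).symm)
    exact ((sq_eq_sq₀ (norm_nonneg _) (norm_nonneg _)).1 h).symm
  let f' : P.Space →ₗᵢ[ℂ] A := ⟨f, hnorm⟩
  let g : UniformSpace.Completion P.Space →L[ℂ] A :=
    f'.toContinuousLinearMap.extend UniformSpace.Completion.toComplL
  have hg : ∀ x : P.Space, g (x : UniformSpace.Completion P.Space) = f x := fun x =>
    ContinuousLinearMap.extend_eq _ UniformSpace.Completion.denseRange_coe
      (UniformSpace.Completion.isUniformInducing_coe P.Space) x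
  have hgn : ∀ x, ‖g x‖ = ‖x‖ := fun x => by
    induction x using UniformSpace.Completion.induction_on with
    | hp => exact isClosed_eq g.continuous.norm continuous_norm
    | ih x => rw [hg, UniformSpace.Completion.norm_coe, hnorm]
  refine ⟨g.toLinearMap, ⟨?_, fun a => ?_⟩, g.continuous, hg, fun x y => ?_⟩
  · exact (AddMonoidHomClass.isometry_of_norm g hgn).injective
  · obtain ⟨x, rfl⟩ := hf a
    exact ⟨_, hg x⟩
  · change star (g x) * g y = P.complInner x y
    change UniformSpace.Completion P.Space at x y
    induction x, y using UniformSpace.Completion.induction_on₂ with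
    | hp =>
      exact isClosed_eq ((g.continuous.comp continuous_fst).star.mul
        (g.continuous.comp continuous_snd))
        (P.continuous_complInner_comp continuous_fst continuous_snd)
    | ih x y =>
      rw [hg, hg, P.complInner_coe]
      exact hinner x y

namespace DirectedGraph

/-! ### Point masses and path tensors in the graph correspondence. -/

section Correspondence

variable {V E : Type*} [TopologicalSpace V] [Finite V] (G : DirectedGraph V E)

theorem zeroAtInfty_of_finite {F : Type*} [TopologicalSpace F] [Zero F] (f : V → F) :
    Filter.Tendsto f (Filter.cocompact V) (nhds 0) := by
  rw [Filter.cocompact_eq_bot]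
  exact Filter.tendsto_bot

variable [DiscreteTopology V]

variable (V) in
/-- On a finite discrete space every function is in `C₀`. -/
def toC0 (f : V → ℂ) : C₀(V, ℂ) :=
  ⟨⟨f, continuous_of_discreteTopology⟩, zeroAtInfty_of_finite f⟩

@[simp]
theorem toC0_apply (f : V → ℂ) (v : V) : toC0 V f v = f v := rfl

/-- Vanishing at infinity is no condition on a finite vertex set; only summability over the possibly
infinite fibres of `r` remains. -/
theorem mem_corrSubmodule_of_summable {ξ : E → ℂ}
    (h : ∀ v, Summable fun e : {e : E // G.r e = v} => ‖ξ e‖ ^ 2) : ξ ∈ G.corrSubmodule :=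
  ⟨⟨⟨fun v => ∑' e : {e : E // G.r e = v}, ‖ξ e‖ ^ 2, continuous_of_discreteTopology⟩,
    zeroAtInfty_of_finite _⟩, fun v => (h v).hasSum⟩

open Classical in
theorem single_mem_corrSubmodule (e : E) : (Pi.single e 1 : E → ℂ) ∈ G.corrSubmodule := by
  refine G.mem_corrSubmodule_of_summable fun v => summable_of_hasFiniteSupport ?_
  refine Set.Finite.subset (s := {x | x.1 = e})
    (Set.Subsingleton.finite fun x hx y hy => Subtype.ext (hx.trans hy.symm)) fun x hx => ?_
  by_contra h
  exact hx (by simp [Pi.single_eq_of_ne (show x.1 ≠ e from h)])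

open Classical in
/-- The point mass at an edge. -/
def edgeVec (e : E) : G.correspondence.Carrier :=
  (⟨Pi.single e 1, G.single_mem_corrSubmodule e⟩ : G.corrSubmodule)

theorem inner_edgeVec_of_ne {e f : E} (h : e ≠ f) :
    G.correspondence.toPre.inner (G.edgeVec e) (G.edgeVec f) = 0 := by
  classical
  ext v
  refine (G.corrInner_apply _ _ v).trans ?_
  refine (tsum_congr fun x => ?_).trans tsum_zero
  change star (Pi.single (M := fun _ => ℂ) e 1 x.1) * Pi.single (M := fun _ => ℂ) f 1 x.1 = 0
  by_cases hx : x.1 = e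
  · simp [hx, h]
  · simp [Pi.single_apply, hx]

open Classical in
theorem inner_edgeVec_self (e : E) :
    G.correspondence.toPre.inner (G.edgeVec e) (G.edgeVec e) = toC0 V (Pi.single (G.r e) 1) := by
  ext v
  refine (G.corrInner_apply _ _ v).trans ?_
  rw [toC0_apply]
  change ∑' x : {x : E // G.r x = v},
    star (Pi.single (M := fun _ => ℂ) e 1 x.1) * Pi.single (M := fun _ => ℂ) e 1 x.1 = _
  by_cases hv : G.r e = v
  · subst hv
    rw [tsum_eq_single ⟨e, rfl⟩]
    · simp
    · intro x hx
      have : x.1 ≠ e := fun h => hx (Subtype.ext h)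
      simp [Pi.single_eq_of_ne this]
  · rw [Pi.single_eq_of_ne (Ne.symm hv)]
    refine (tsum_congr fun x => ?_).trans tsum_zero
    have : x.1 ≠ e := fun h => hv (h ▸ x.2)
    simp [Pi.single_eq_of_ne this]

theorem lact_edgeVec (a : C₀(V, ℂ)) (e : E) :
    G.correspondence.toPre.lact a (G.edgeVec e) = a (G.s e) • G.edgeVec e := by
  classical
  refine Subtype.ext (funext fun x => ?_)
  change a (G.s x) * Pi.single (M := fun _ => ℂ) e 1 x
    = a (G.s e) * Pi.single (M := fun _ => ℂ) e 1 x
  by_cases hx : x = e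
  · rw [hx]
  · simp [Pi.single_eq_of_ne hx]

/-- The elementary tensor `δ_{p 0} ⊗ (δ_{p 1} ⊗ ⋯ δ_{p n})`. -/
def pathVec : (n : ℕ) → (ℕ → E) → (G.correspondence.tensorPowSucc n).Carrier
  | 0, p => G.edgeVec (p 0)
  | n + 1, p => G.correspondence.tmul (G.correspondence.tensorPowSucc n) (G.edgeVec (p 0))
      (pathVec n fun i => p (i + 1))

theorem lact_pathVec (a : C₀(V, ℂ)) : ∀ (n : ℕ) (p : ℕ → E),
    (G.correspondence.tensorPowSucc n).toPre.lact a (G.pathVec n p)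
      = a (G.s (p 0)) • G.pathVec n p
  | 0, p => G.lact_edgeVec a (p 0)
  | n + 1, p => by
    refine (CStarCorrespondence.lact_tmul ..).trans ?_
    rw [lact_edgeVec, CStarCorrespondence.tmul_smul_left]
    rfl

/-- The inner product of the first factors acts on the remaining ones, and it is already zero. -/
theorem inner_pathVec_of_ne {p q : ℕ → E} (h : p 0 ≠ q 0) : ∀ n,
    (G.correspondence.tensorPowSucc n).toPre.inner (G.pathVec n p) (G.pathVec n q) = 0
  | 0 => G.inner_edgeVec_of_ne h
  | n + 1 => by
    refine (CStarCorrespondence.inner_tmul ..).trans ?_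
    rw [G.inner_edgeVec_of_ne h, map_zero, LinearMap.zero_apply, map_zero]

open Classical in
-- The first factor contributes the point mass at `r(p 0) = s(p 1)`, which acts as the identity on
-- the tensor of the remaining edges. Peeling off factors leaves the last edge. Only `p 0, …, p n`
-- enter the tensor; an infinite sequence avoids index bounds.
theorem inner_pathVec_self : ∀ (n : ℕ) {p : ℕ → E}, (∀ i, G.r (p i) = G.s (p (i + 1))) →
    (G.correspondence.tensorPowSucc n).toPre.inner (G.pathVec n p) (G.pathVec n p)
      = toC0 V (Pi.single (G.r (p n)) 1)
  | 0, p, _ => G.inner_edgeVec_self (p 0)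
  | n + 1, p, hp => by
    refine (CStarCorrespondence.inner_tmul ..).trans ?_
    rw [G.inner_edgeVec_self, lact_pathVec, toC0_apply, hp, Pi.single_eq_same, one_smul]
    exact inner_pathVec_self n fun i => hp (i + 1)

/-! ### Twisted identity correspondences and periodicity of simple cycles. -/

/-- `X` is isomorphic to `C₀(V)` with multiplication on the right, `⟨a, b⟩ = a* b` and the left
action `a · b = (a ∘ α) b`. -/
def IsTwistedSelf (X : CStarCorrespondence C₀(V, ℂ)) (α : V → V) : Prop :=
  ∃ Φ : X.Carrier →ₗ[ℂ] C₀(V, ℂ), Function.Bijective Φ ∧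
    (∀ a x v, Φ (X.toPre.lact a x) v = a (α v) * Φ x v) ∧
    ∀ x y v, X.toPre.inner x y v = star (Φ x v) * Φ y v

/-- Here `r` is a bijection with inverse `t`, so `ξ ↦ ξ ∘ t` turns functions on edges into functions
on vertices. Each inner product sum has a single term, and the left action reads `a` at `s(t v)`. -/
theorem isTwistedSelf_correspondence (t : V → E) (ht : ∀ v, G.r (t v) = v)
    (hr : Function.Injective G.r) : IsTwistedSelf G.correspondence (G.s ∘ t) := by
  have hfib : ∀ v, Subsingleton {e : E // G.r e = v} := fun v =>
    ⟨fun x y => Subtype.ext (hr (x.2.trans y.2.symm))⟩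
  let Φ : G.corrSubmodule →ₗ[ℂ] C₀(V, ℂ) :=
    { toFun := fun ξ => toC0 V fun v => ξ.1 (t v)
      map_add' := fun _ _ => rfl
      map_smul' := fun _ _ => rfl }
  have htr : ∀ e, t (G.r e) = e := fun e => hr (ht _)
  refine ⟨Φ, ⟨fun ξ η h => ?_, fun a => ?_⟩, fun a ξ v => rfl, fun ξ η v => ?_⟩
  · refine Subtype.ext (funext fun e => ?_)
    rw [← htr e]
    exact DFunLike.congr_fun h (G.r e)
  · refine ⟨(⟨fun e => a (G.r e), G.mem_corrSubmodule_of_summable fun v =>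
      summable_of_hasFiniteSupport (Set.toFinite _)⟩ : G.corrSubmodule), ?_⟩
    ext v
    exact congrArg a (ht v)
  · exact tsum_eq_single (⟨t v, ht v⟩ : {e : E // G.r e = v}) fun x hx =>
      absurd (Subsingleton.elim _ _) hx

/-- The map is `x ⊗ y ↦ (Φ x ∘ β) · Ψ y`. Balancing suggests the formula: moving `Φ x` across the
tensor sign lets it act on `Y` from the left, that is, through `β`. -/
theorem IsTwistedSelf.tensor {X Y : CStarCorrespondence C₀(V, ℂ)} {α β : V → V}
    (hX : IsTwistedSelf X α) (hY : IsTwistedSelf Y β) : IsTwistedSelf (X.tensor Y) (α ∘ β) := by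
  obtain ⟨Φ, hΦ, hΦl, hΦi⟩ := hX
  obtain ⟨Ψ, hΨ, hΨl, hΨi⟩ := hY
  let P := X.toPre.tensor Y.toPre
  let F : X.Carrier ⊗[ℂ] Y.Carrier →ₗ[ℂ] C₀(V, ℂ) := TensorProduct.lift <|
    LinearMap.mk₂ ℂ (fun x y => toC0 V fun v => Φ x (β v) * Ψ y v)
      (fun x x' y => by ext v; simp [add_mul]) (fun c x y => by ext v; simp [mul_assoc])
      (fun x y y' => by ext v; simp [mul_add]) (fun c x y => by ext v; simp [mul_left_comm])
  have hF : ∀ x y v, F (x ⊗ₜ y) v = Φ x (β v) * Ψ y v := fun _ _ _ => rfl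
  have hFi : ∀ x y, star (F x) * F y = P.inner x y := by
    intro x y
    induction x with
    | zero => simp
    | add x₁ x₂ h₁ h₂ => simp only [map_add, star_add, add_mul, h₁, h₂, LinearMap.add_apply]
    | tmul x x' =>
      induction y with
      | zero => simp
      | add y₁ y₂ h₁ h₂ => simp only [map_add, mul_add, h₁, h₂]
      | tmul y y' =>
        ext v
        change star (F (x ⊗ₜ x') v) * F (y ⊗ₜ y') v
          = Y.toPre.inner x' (Y.toPre.lact (X.toPre.inner x y) y') v
        rw [hF, hF, hΨi, hΨl, hΦi, star_mul]
        ring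
  have hFs : Function.Surjective F := fun a => by
    -- Finiteness of `V` puts the constant 1 in `C₀(V)`, so elementary tensors alone exhaust the
    -- target.
    obtain ⟨x, hx⟩ := hΦ.2 (toC0 V fun _ => 1)
    obtain ⟨y, hy⟩ := hΨ.2 a
    refine ⟨x ⊗ₜ y, ?_⟩
    ext v
    rw [hF, hx, hy, toC0_apply, one_mul]
  obtain ⟨g, hgb, hgc, hgF, hgi⟩ := P.exists_completion_linearMap F hFs hFi
  refine ⟨g, hgb, fun a x v => ?_, fun x y v => (DFunLike.congr_fun (hgi x y) v).symm⟩
  -- With continuous evaluations, the twisted left action need only be checked on the dense image of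
  -- the algebraic tensor product.
  have hev : ∀ v, Continuous fun f : C₀(V, ℂ) => f v := fun v =>
    (BoundedContinuousFunction.lipschitz_eval_const v).continuous.comp
      (ZeroAtInftyContinuousMap.isometry_toBCF (α := V) (β := ℂ)).continuous
  change g (PreCorrespondence.complAct P.norm_lact_space_le a x) v = _
  change UniformSpace.Completion P.Space at x
  induction x using UniformSpace.Completion.induction_on with
  | hp =>
    exact isClosed_eq ((hev v).comp (hgc.comp (PreCorrespondence.continuous_complAct _ a)))
      (continuous_const.mul ((hev v).comp hgc))
  | ih x =>
    rw [PreCorrespondence.complAct_coe]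
    refine (DFunLike.congr_fun (hgF (P.lact a x)) v).trans (Eq.trans ?_
      (congrArg (a ((α ∘ β) v) * ·) (DFunLike.congr_fun (hgF x) v).symm))
    change F (P.lact a x) v = _ * F x v
    change X.Carrier ⊗[ℂ] Y.Carrier at x
    induction x with
    | zero => simp
    | add x₁ x₂ h₁ h₂ =>
      simp only [map_add, ZeroAtInftyContinuousMap.add_apply, h₁, h₂, mul_add]
    | tmul x y =>
      change F (X.toPre.lact a x ⊗ₜ y) v = _
      rw [hF, hF, hΦl, mul_assoc]
      rfl

theorem IsTwistedSelf.tensorPowSucc {X : CStarCorrespondence C₀(V, ℂ)} {α : V → V}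
    (hX : IsTwistedSelf X α) : ∀ n, IsTwistedSelf (X.tensorPowSucc n) α^[n + 1]
  | 0 => hX
  | n + 1 => by
    rw [Function.iterate_succ' α (n + 1)]
    exact hX.tensor (hX.tensorPowSucc n)

theorem IsSimpleCycle.not_nonperiodic (h : G.IsSimpleCycle) : ¬ G.correspondence.Nonperiodic := by
  obtain ⟨n, v, e, hve⟩ := h
  have hr : ∀ i, G.r (e i) = v (i + 1) := fun i => (hve i).2
  -- The only edge into `vᵢ` is `eᵢ₋₁`, so `s ∘ t` is the predecessor map `vᵢ ↦ vᵢ₋₁`.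
  let t : V → E := fun w => e (v.symm w - 1)
  have ht : ∀ w, G.r (t w) = w := fun w => by simp [t, hr]
  have hinj : Function.Injective G.r := fun a b hab => by
    obtain ⟨i, rfl⟩ := e.surjective a
    obtain ⟨j, rfl⟩ := e.surjective b
    rw [hr, hr] at hab
    rw [add_right_cancel (v.injective hab)]
  have hiter : ∀ (m : ℕ) i, (G.s ∘ t)^[m] (v i) = v (i - m • (1 : Fin (n + 1))) := by
    intro m
    induction m with
    | zero => simp
    | succ m ih =>
      intro i
      rw [Function.iterate_succ_apply', ih]
      simp only [t, Function.comp_apply, (hve _).1, Equiv.symm_apply_apply, sub_sub, succ_nsmul]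
  have hid : ∀ w, (G.s ∘ t)^[n + 1] w = w := fun w => by
    obtain ⟨i, rfl⟩ := v.surjective w
    have h0 : (n + 1) • (1 : Fin (n + 1)) = 0 := by
      simpa using card_nsmul_eq_zero' (x := (1 : Fin (n + 1)))
    rw [hiter, h0, sub_zero]
  obtain ⟨Φ, hb, hl, hi⟩ := (G.isTwistedSelf_correspondence t ht hinj).tensorPowSucc n
  intro hnp
  refine n.succ_ne_zero (hnp (n + 1) ⟨Φ, hb, fun a x => ?_, fun x y => ?_⟩)
  · refine DFunLike.ext (F := C₀(V, ℂ)) _ _ fun w => ?_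
    rw [hl, hid]
    rfl
  · exact DFunLike.ext (F := C₀(V, ℂ)) _ _ fun w => (hi x y w).symm

end Correspondence

/-! ### Strongly connected graphs with a cycle without exit. -/

section Paths

variable {V E : Type*} {G : DirectedGraph V E}

/-- A path from `v` to the source of a given edge either has a first edge or has length zero, and
then the given edge itself starts at `v`. This lets every path be prolonged. -/
theorem StronglyConnected.exists_source_eq (hG : G.StronglyConnected) [Nonempty E] (v : V) :
    ∃ e, G.s e = v := by
  obtain ⟨e⟩ := ‹Nonempty E›
  rcases hG v (G.s e) with h | ⟨α, hα, -⟩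
  · exact ⟨e, h.symm⟩
  · exact ⟨_, hα⟩

theorem exists_cycle_edges {p : ℕ → E} (hp : ∀ i, G.r (p i) = G.s (p (i + 1))) (n : ℕ)
    (h : G.r (p n) = G.s (p 0)) : ∃ α : G.Path, α.IsCycle := by
  refine ⟨⟨(List.range (n + 1)).map p, by simp, ?_⟩, ?_⟩
  · rw [List.isChain_iff_getElem]
    intro i hi
    simpa using hp i
  · simp [Path.IsCycle, Path.source, Path.range, List.getLast_map, List.head_map, h]

/-- The periodic sequence of edges that runs through a cycle. -/
theorem Path.IsCycle.exists_periodic {α : G.Path} (h : α.IsCycle) :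
    ∃ (p : ℕ → E) (k : ℕ), 0 < k ∧ (∀ i, p (i + k) = p i) ∧ (∀ i, p i ∈ α.edges) ∧
      ∀ i, G.r (p i) = G.s (p (i + 1)) := by
  have hk : 0 < α.edges.length := List.length_pos_iff.2 α.ne_nil
  refine ⟨fun i => α.edges[i % α.edges.length]'(Nat.mod_lt _ hk), α.edges.length, hk,
    fun i => by simp, fun i => List.getElem_mem _, fun i => ?_⟩
  have hc := List.isChain_iff_getElem.1 α.chain
  have hlt := Nat.mod_lt i hk
  by_cases hi : i % α.edges.length + 1 < α.edges.length
  · have h1 : (i + 1) % α.edges.length = i % α.edges.length + 1 := by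
      rw [Nat.add_mod, Nat.mod_eq_of_lt (a := 1) (by omega), Nat.mod_eq_of_lt hi]
    simp only [h1]
    exact hc _ hi
  -- At the wraparound from the last edge to the first, the closing of the cycle replaces the chain
  -- condition.
  · have h0 : i % α.edges.length = α.edges.length - 1 := by omega
    have h1 : (i + 1) % α.edges.length = 0 := by
      rw [← Nat.mod_add_mod, h0, Nat.sub_add_cancel hk, Nat.mod_self]
    simp only [h0, h1]
    have := h.symm
    rwa [Path.source, Path.range, List.getLast_eq_getElem, List.head_eq_getElem] at this

/-- Without exits, each edge of the cycle is the only edge leaving its source, so a path starting on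
the cycle follows it forever. Strong connectedness puts every vertex on the cycle, hence every edge
too. It remains to count each edge once, since the given cycle may run round several times. -/
theorem StronglyConnected.isSimpleCycle (hG : G.StronglyConnected) (hL : ¬ G.ConditionL) :
    G.IsSimpleCycle := by
  unfold ConditionL Path.IsExit at hL
  push Not at hL
  obtain ⟨α, hα, hex⟩ := hL
  obtain ⟨p, k, hk, hpk, hmem, hp⟩ := hα.exists_periodic
  have huniq : ∀ i f, G.s f = G.s (p i) → f = p i := fun i f => hex f _ (hmem i)
  have hpath : ∀ (l : List E) (hl : l ≠ []) (i : ℕ), l.IsChain (fun e f => G.r e = G.s f) →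
      G.s (l.head hl) = G.s (p i) → ∃ j, G.r (l.getLast hl) = G.s (p j) := by
    intro l
    induction l with
    | nil => exact fun hl => absurd rfl hl
    | cons e l ih =>
      intro hl i hc hs
      have he := huniq i e hs
      cases l with
      | nil => exact ⟨i + 1, by rw [List.getLast_singleton, he, hp]⟩
      | cons f l =>
        rw [List.isChain_cons_cons] at hc
        rw [List.getLast_cons (List.cons_ne_nil f l)]
        exact ih _ (i + 1) hc.2 (by rw [List.head_cons, ← hc.1, he, hp])
  have hsurj : ∀ v, ∃ i, G.s (p i) = v := by
    intro v
    rcases hG (G.s (p 0)) v with h | ⟨β, hβ, rfl⟩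
    · exact ⟨0, h⟩
    · obtain ⟨j, hj⟩ := hpath β.edges β.ne_nil 0 β.chain hβ
      exact ⟨j, hj.symm⟩
  have hpsurj : Function.Surjective p := fun f => by
    obtain ⟨i, hi⟩ := hsurj (G.s f)
    exact ⟨i, (huniq i f hi.symm).symm⟩
  have hinj : Function.Injective G.s := fun f f' h => by
    obtain ⟨i, rfl⟩ := hpsurj f'
    exact huniq i f h
  have hsb : Function.Bijective G.s := ⟨hinj, fun v => (hsurj v).imp' p fun _ => id⟩
  -- `h` sends an edge to the unique edge that follows it; all edges form one orbit of `h`.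
  choose h hh using fun e => hsb.2 (G.r e)
  have hit : ∀ i, h^[i] (p 0) = p i := by
    intro i
    induction i with
    | zero => rfl
    | succ i ih => rw [Function.iterate_succ_apply', ih]; exact hinj (by rw [hh, hp])
  have hper : h^[k] (p 0) = p 0 := by rw [hit, ← hpk 0, zero_add]
  have hpos : 0 < Function.minimalPeriod h (p 0) := Function.IsPeriodicPt.minimalPeriod_pos hk hper
  -- The number of edges is the minimal period; `k` is only a multiple of it.
  obtain ⟨n, hn⟩ : ∃ n, Function.minimalPeriod h (p 0) = n + 1 := ⟨_, (Nat.sub_add_cancel hpos).symm⟩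
  let e : Fin (n + 1) ≃ E := Equiv.ofBijective (fun i => h^[i] (p 0)) ⟨fun i j hij => by
      have := (Function.iterate_eq_iterate_iff_of_lt_minimalPeriod
        (by rw [hn]; exact i.2) (by rw [hn]; exact j.2)).1 hij
      exact Fin.ext this, fun f => by
      obtain ⟨i, rfl⟩ := hpsurj f
      refine ⟨⟨i % (n + 1), Nat.mod_lt _ n.succ_pos⟩, ?_⟩
      change h^[i % (n + 1)] (p 0) = p i
      rw [← hn, Function.iterate_mod_minimalPeriod_eq, hit]⟩
  refine ⟨n, e.trans (Equiv.ofBijective _ hsb), e, fun i => ⟨rfl, ?_⟩⟩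
  change G.r (h^[i] (p 0)) = G.s (h^[(i + 1 : Fin (n + 1))] (p 0))
  -- Addition in `Fin (n + 1)` wraps around, which the period of `h` absorbs.
  have h1 : ((i + 1 : Fin (n + 1)) : ℕ) = (i + 1) % (n + 1) := by
    rw [Fin.val_add, Fin.val_one', Nat.add_mod_mod]
  have h2 : h^[(i + 1) % (n + 1)] (p 0) = h^[(i : ℕ) + 1] (p 0) := by
    rw [← Function.iterate_mod_minimalPeriod_eq (n := i + 1), hn]
  rw [h1, h2, Function.iterate_succ_apply', hh]

end Paths

/-! ### Condition (L) implies nonperiodicity. -/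

section Iso

variable {V E : Type*} [TopologicalSpace V] [DiscreteTopology V] [Finite V] [Nonempty V]
  {G : DirectedGraph V E}

theorem StronglyConnected.nonperiodic (hG : G.StronglyConnected) (hL : G.ConditionL) :
    G.correspondence.Nonperiodic := by
  classical
  rintro (_ | n) hn
  · rfl
  exfalso
  obtain ⟨Φ, hΦ, hl, hi⟩ : ∃ Φ : (G.correspondence.tensorPowSucc n).Carrier → C₀(V, ℂ),
      Function.Bijective Φ ∧
      (∀ a x, Φ ((G.correspondence.tensorPowSucc n).toPre.lact a x) = a * Φ x) ∧
      ∀ x y, star (Φ x) * Φ y = (G.correspondence.tensorPowSucc n).toPre.inner x y := hn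
  -- Without edges `X(E)` and its powers vanish, whereas `A ≠ 0` because there is a vertex.
  rcases isEmpty_or_nonempty E with hE | hE
  · have h1 : Subsingleton G.correspondence.Carrier := ⟨fun ξ η => Subtype.ext (Subsingleton.elim _ _)⟩
    have h2 := G.correspondence.subsingleton_tensorPowSucc n
    have h3 : Subsingleton C₀(V, ℂ) := hΦ.2.subsingleton
    obtain ⟨v⟩ := ‹Nonempty V›
    exact one_ne_zero (α := ℂ)
      (DFunLike.congr_fun (Subsingleton.elim (toC0 V fun _ => 1) 0) v)
  -- A choice of a following edge gives every edge `e` an infinite path `e, h e, h² e, …`; `φ e` is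
  -- the image of the tensor of its first `n + 1` edges.
  choose h hh using fun e => hG.exists_source_eq (G.r e)
  have hp : ∀ e i, G.r (h^[i] e) = G.s (h^[i + 1] e) := fun e i => by
    rw [Function.iterate_succ_apply', hh]
  let φ : E → C₀(V, ℂ) := fun e => Φ (G.pathVec n fun i => h^[i] e)
  have hinner : ∀ e f v, star (φ e v) * φ f v
      = (G.correspondence.tensorPowSucc n).toPre.inner (G.pathVec n fun i => h^[i] e)
        (G.pathVec n fun i => h^[i] f) v := fun e f v => by
    rw [← hi]
    rfl
  -- The point mass at `s(e)` fixes the path tensor, hence multiplication by it fixes `φ e`. The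
  -- scalar is 1, so no linearity of `Φ` is called for.
  have hsupp : ∀ e v, v ≠ G.s e → φ e v = 0 := by
    intro e v hv
    have h1 := hl (toC0 V (Pi.single (G.s e) 1)) (G.pathVec n fun i => h^[i] e)
    rw [lact_pathVec, toC0_apply, Function.iterate_zero_apply, Pi.single_eq_same, one_smul] at h1
    have h2 : φ e v = toC0 V (Pi.single (G.s e) 1) v * φ e v := DFunLike.congr_fun h1 v
    rw [h2, toC0_apply, Pi.single_eq_of_ne hv, zero_mul]
  have hself : ∀ e v, star (φ e v) * φ e v = Pi.single (M := fun _ => ℂ) (G.r (h^[n] e)) 1 v :=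
    fun e v => by rw [hinner, G.inner_pathVec_self n (hp e), toC0_apply]
  -- `|φ e|²` is the point mass at the end of the path, while `φ e` lives at its beginning.
  have hrange : ∀ e, G.r (h^[n] e) = G.s e := fun e => by
    by_contra hne
    have h1 := hself e (G.r (h^[n] e))
    rw [hsupp e _ hne, mul_zero, Pi.single_eq_same] at h1
    exact zero_ne_one h1
  have hne : ∀ e, φ e (G.s e) ≠ 0 := fun e h0 => by
    have h1 := hself e (G.s e)
    rw [h0, mul_zero, hrange, Pi.single_eq_same] at h1
    exact zero_ne_one h1
  obtain ⟨e⟩ := hE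
  obtain ⟨α, hα⟩ := exists_cycle_edges (hp e) n (hrange e)
  obtain ⟨f, e', -, hs, hfe⟩ := hL α hα
  -- The exit `f` and the edge `e'` are compared as first edges of their own paths; the position of
  -- `e'` in the cycle does not matter.
  have h1 := hinner f e' (G.s e')
  rw [G.inner_pathVec_of_ne (by exact hfe), ZeroAtInftyContinuousMap.zero_apply] at h1
  rcases mul_eq_zero.1 h1 with h2 | h2
  · exact hne f (by rw [hs]; exact star_eq_zero.1 h2)
  · exact hne e' h2

end Iso

end DirectedGraph

end

theorem mainTheorem7 {V E : Type*} [TopologicalSpace V] [DiscreteTopology V] [Finite V] [Nonempty V]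
    (G : DirectedGraph V E) (hG : G.StronglyConnected) :
    List.TFAE [G.correspondence.Nonperiodic, ¬ G.IsSimpleCycle, G.ConditionL] := by
  tfae_have 1 → 2 := fun h hc => hc.not_nonperiodic G h
  tfae_have 2 → 3 := fun h => by_contra fun hL => h (hG.isSimpleCycle hL)
  tfae_have 3 → 1 := hG.nonperiodic
  tfae_finish
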